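/- Let $d\ge 1$ and let $W\in\mathbb R^{N_1\times N_2}$, $N_1=n_1\cdots n_d$, $N_2=n_{d+1}\cdots n_{2d}$, be given in tensor-train format with cores $G_i\in\mathbb R^{r_{i-1}\times n_i\times r_i}$ ($1\le i\le 2d$), where $1=r_0<r_1\le\cdots\le r_d\ge r_{d+1}\ge\cdots\ge r_{2d}=1$, and suppose that every core has more than one entry, i.e. $r_{i-1}n_ir_i>1$ (this is automatic if $r_{2d-1}>1$ and all $n_i\ge 1$). The forward pass $Y=XW$ contracts the tensor network formed by $X\in\mathbb R^{b\times n_1\times\cdots\times n_d}$ and $G_1,\dots,G_{2d}$, where neighbouring cores share a rank index and $X$ shares the index of size $n_i$ with $G_i$ for $i\le d$. A contraction path is a binary tree of pairwise contractions that uses each of $X,G_1,\dots,G_{2d}$ exactly once (the order of contractions that do not depend on each other is disregarded). A contraction of two tensors sums over the indices they share, outer products being allowed, and costs as many flops as the product of the dimensions of all distinct indices occurring in the two tensors; the flops of a path are the sum over its contractions. Then there is $b_0$, depending only on $d$, the $n_i$ and the $r_i$, such that for every batch size $b\ge b_0$ a contraction path with the least number of flops exists, and every such path has the following form. There are $k\ge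 1$ and integers $0=j_1<j_2<\cdots<j_k<j_{k+1}=2d$ such that, for each $1\le i\le k$, the path contracts the consecutive cores $G_{j_i+1},\dots,G_{j_{i+1}}$ with each other into a tensor $V_i$ of dimension $r_{j_i}\times n_{j_i+1}\times\cdots\times n_{j_{i+1}}\times r_{j_{i+1}}$, and then contracts $X$ with $V_1,V_2,\dots,V_k$, one after the other in this order. -/

import Mathlib

/-- The named indices of the tensor network of the forward pass `Y = X W`, with `W` in tensor-train
format with `2 d` cores: the batch index, the modes `1, …, 2 d`, and the bonds `0, …, 2 d`
(bond `i` joins core `i` to core `i + 1`). -/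
inductive TTIndex : Type
  | batch : TTIndex
  | mode (i : ℕ) : TTIndex
  | bond (i : ℕ) : TTIndex
  deriving DecidableEq

/-- The tensors that are given: the (reshaped) input `X` and the cores `G_1, …, G_{2d}`. -/
inductive TTInput : Type
  | X : TTInput
  | core (i : ℕ) : TTInput

/-- The indices carried by a given tensor: `X` is of shape `b × n_1 × ⋯ × n_d`, and `G_i` is of
shape `r_{i-1} × n_i × r_i`. -/
def TTInput.indices (d : ℕ) : TTInput → Finset TTIndex
  | .X => insert TTIndex.batch ((Finset.Icc 1 d).image TTIndex.mode)
  | .core i => {TTIndex.bond (i - 1), TTIndex.mode i, TTIndex.bond i}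

/-- The dimension of each index, for batch size `b`, mode sizes `n` and TT ranks `r`. -/
def TTIndex.dim (b : ℕ) (n r : ℕ → ℕ) : TTIndex → ℕ
  | .batch => b
  | .mode i => n i
  | .bond i => r i

/-- Binary trees of pairwise contractions. Every node stands for the tensor that it computes: a
leaf for a given tensor, `contract P Q` for the contraction of the tensors of `P` and `Q`.
Any two tensors may be contracted, also if they share no index (outer product). -/
inductive ContractionTree : Type
  | input (t : TTInput) : ContractionTree
  | contract (P Q : ContractionTree) : ContractionTree

namespace ContractionTree

/-- The given tensors that occur in a tree, with multiplicity. -/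
def leaves : ContractionTree → Multiset TTInput
  | input t => {t}
  | contract P Q => leaves P + leaves Q

/-- The indices of the tensor computed by a tree. A contraction sums over the indices shared by its
two operands and keeps all the others (every index occurs in at most two of the given tensors, and
the indices of the output occur in one only). -/
def indices (d : ℕ) : ContractionTree → Finset TTIndex
  | input t => t.indices d
  | contract P Q => symmDiff (indices d P) (indices d Q)

/-- The number of flops: contracting two tensors takes one multiplication for every joint value of
all the indices that occur in at least one of them. -/
def flops (b d : ℕ) (n r : ℕ → ℕ) : ContractionTree → ℕ
  | input _ => 0
  | contract P Q =>
      flops b d n r P + flops b d n r Q + ∏ a ∈ indices d P ∪ indices d Q, a.dim b n r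

/-- A contraction path for the forward pass: a tree that uses each of `X, G_1, …, G_{2d}`
exactly once. -/
def IsForwardPath (d : ℕ) (P : ContractionTree) : Prop :=
  P.leaves = TTInput.X ::ₘ (Finset.Icc 1 (2 * d)).val.map TTInput.core

/-- A contraction path for the forward pass with the least number of flops. -/
def IsFlopOptimal (b d : ℕ) (n r : ℕ → ℕ) (P : ContractionTree) : Prop :=
  P.IsForwardPath d ∧
    ∀ Q : ContractionTree, Q.IsForwardPath d → P.flops b d n r ≤ Q.flops b d n r

/-- `P` contracts the input `X` with the tensors of `V 1, …, V k`, one after the other and in this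
order (the two operands of a contraction may be written in either order). -/
def IsSequential (V : ℕ → ContractionTree) : ℕ → ContractionTree → Prop
  | 0, P => P = input TTInput.X
  | k + 1, P => ∃ Q : ContractionTree, IsSequential V k Q ∧
      (P = contract Q (V (k + 1)) ∨ P = contract (V (k + 1)) Q)

end ContractionTree

/-! Follow the branch of the tree from the leaf `X` to the root. Its contractions are the only ones
that involve the batch index, so each costs at least `b`, whereas contractions among cores cost an
amount independent of `b`. Replace the set of cores absorbed so far by the initial segment `1, …,
e`, with `e` the front of that set, and replace each step by a contraction with the chain (`comb`)
of cores between the old and the new front. By `indices_front_subset` the new step needs no index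
that the old one lacks, except bond `0`, of dimension one. If the front does not advance, the whole
step is saved. If it advances but the absorbed set is not an initial segment, `exists_extra_index`
gives an index of dimension at least two that the new step avoids, so its cost is at most half.
Either way at least `b` flops are saved, while all chains together cost at most `2 * d * F`. This is
the induction `exists_sequential_flops_le`. Once `b > 2 * d * F`, every step of an optimal path must
lengthen an initial segment, which is the claimed form. -/

namespace ContractionTree

/-! ### Indices and costs of a tree, read off from its leaves -/

/-- A tree over the network uses each given tensor at most once, and only cores `1, …, 2 d`. -/
structure IsPartial (d : ℕ) (P : ContractionTree) : Prop where
  nodup : P.leaves.Nodup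
  range : ∀ i, TTInput.core i ∈ P.leaves → 1 ≤ i ∧ i ≤ 2 * d

theorem leaves_contract_comm (P Q : ContractionTree) :
    (contract P Q).leaves = (contract Q P).leaves :=
  add_comm _ _

theorem flops_contract_comm (b d : ℕ) (n r : ℕ → ℕ) (P Q : ContractionTree) :
    (contract P Q).flops b d n r = (contract Q P).flops b d n r := by
  simp only [flops, Finset.union_comm (indices d P)]
  ring

theorem mem_leaves_contract {P Q : ContractionTree} {t : TTInput} :
    t ∈ (contract P Q).leaves ↔ t ∈ P.leaves ∨ t ∈ Q.leaves :=
  Multiset.mem_add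

theorem IsPartial.of_contract {d : ℕ} {P Q : ContractionTree} (h : (contract P Q).IsPartial d) :
    P.IsPartial d ∧ Q.IsPartial d ∧ ∀ t, t ∈ P.leaves → t ∉ Q.leaves := by
  obtain ⟨h1, h2, h3⟩ := Multiset.nodup_add.1 h.nodup
  exact ⟨⟨h1, fun i hi => h.range i (mem_leaves_contract.2 (Or.inl hi))⟩,
    ⟨h2, fun i hi => h.range i (mem_leaves_contract.2 (Or.inr hi))⟩,
    fun t ht => Multiset.disjoint_left.1 h3 ht⟩

/-- The indices of the tensor computed by a tree, in terms of the leaves of the tree. -/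
theorem IsPartial.mem_indices {d : ℕ} {P : ContractionTree} (h : P.IsPartial d) :
    (TTIndex.batch ∈ P.indices d ↔ TTInput.X ∈ P.leaves) ∧
    (∀ i, TTIndex.mode i ∈ P.indices d ↔
      Xor (TTInput.X ∈ P.leaves ∧ 1 ≤ i ∧ i ≤ d) (TTInput.core i ∈ P.leaves)) ∧
    (∀ i, TTIndex.bond i ∈ P.indices d ↔
      Xor (TTInput.core i ∈ P.leaves) (TTInput.core (i + 1) ∈ P.leaves)) := by
  induction P with
  | input t =>
    cases t with
    | X => simp [indices, leaves, TTInput.indices, xor_def]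
    | core c =>
      have hc := (h.range c (Multiset.mem_singleton_self _)).1
      simp only [indices, leaves, TTInput.indices, xor_def, Multiset.mem_singleton,
        Finset.mem_insert, Finset.mem_singleton, reduceCtorEq, TTIndex.mode.injEq,
        TTIndex.bond.injEq, TTInput.core.injEq, false_or]
      refine ⟨by simp, fun i => by simp, fun i => ?_⟩
      omega
  | contract P Q hP hQ =>
    obtain ⟨h1, h2, h3⟩ := h.of_contract
    obtain ⟨p1, p2, p3⟩ := hP h1
    obtain ⟨q1, q2, q3⟩ := hQ h2
    refine ⟨?_, fun i => ?_, fun i => ?_⟩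
    · have hX := h3 TTInput.X
      simp only [indices, Finset.mem_symmDiff, p1, q1, mem_leaves_contract]
      tauto
    · have hX := h3 TTInput.X
      have hi := h3 (TTInput.core i)
      simp only [indices, Finset.mem_symmDiff, p2, q2, mem_leaves_contract, xor_def]
      grind
    · have hi := h3 (TTInput.core i)
      have hi' := h3 (TTInput.core (i + 1))
      simp only [indices, Finset.mem_symmDiff, p3, q3, mem_leaves_contract, xor_def]
      grind

/-- Only `X` carries the batch index; hence the cost of a chain of cores stays constant as `b`
grows. -/
theorem IsPartial.flops_eq {d : ℕ} {P : ContractionTree} (h : P.IsPartial d)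
    (hX : TTInput.X ∉ P.leaves) (n r : ℕ → ℕ) (b b' : ℕ) :
    P.flops b d n r = P.flops b' d n r := by
  induction P with
  | input t => rfl
  | contract P Q hP hQ =>
    obtain ⟨h1, h2, -⟩ := h.of_contract
    rw [mem_leaves_contract, not_or] at hX
    rw [flops, flops, hP h1 hX.1, hQ h2 hX.2]
    congr 1
    refine Finset.prod_congr rfl fun a ha => ?_
    cases a with
    | batch =>
      rw [Finset.mem_union, h1.mem_indices.1, h2.mem_indices.1] at ha
      tauto
    | mode i => rfl
    | bond i => rfl

theorem IsPartial.dim_pos {b d : ℕ} {n r : ℕ → ℕ}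
    (hcore : ∀ i, i < 2 * d → 1 < r i * n (i + 1) * r (i + 1)) (hb : 1 ≤ b)
    {P : ContractionTree} (h : P.IsPartial d) {a : TTIndex} (ha : a ∈ P.indices d) :
    1 ≤ a.dim b n r := by
  have pos : ∀ i, i < 2 * d → 0 < r i ∧ 0 < n (i + 1) ∧ 0 < r (i + 1) := fun i hi => by
    refine ⟨?_, ?_, ?_⟩ <;> refine Nat.pos_of_ne_zero fun h0 => ?_ <;>
      simpa [h0] using hcore i hi
  cases a with
  | batch => exact hb
  | mode i =>
    have hi : 1 ≤ i ∧ i ≤ 2 * d := by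
      have := h.range i
      rcases (h.mem_indices.2.1 i).1 ha with h1 | h1
      · omega
      · tauto
    obtain ⟨i, rfl⟩ := Nat.exists_eq_add_of_le' hi.1
    exact (pos i (by omega)).2.1
  | bond i =>
    rcases (h.mem_indices.2.2 i).1 ha with h1 | h1
    · have hi := h.range i h1.1
      obtain ⟨i, rfl⟩ := Nat.exists_eq_add_of_le' hi.1
      exact (pos i (by omega)).2.2
    · have hi := h.range _ h1.1
      exact (pos i (by omega)).1

/-! ### Chains of consecutive cores and sequential forms -/

/-- The cores `a + 1, …, a + m + 1`, contracted from left to right. -/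
def comb (a : ℕ) : ℕ → ContractionTree
  | 0 => input (TTInput.core (a + 1))
  | m + 1 => contract (comb a m) (input (TTInput.core (a + m + 2)))

theorem leaves_comb (a m : ℕ) :
    (comb a m).leaves = (Finset.Icc (a + 1) (a + m + 1)).val.map TTInput.core := by
  induction m with
  | zero => simp [comb, leaves]
  | succ m ih =>
    have h : Finset.Icc (a + 1) (a + (m + 1) + 1) =
        Finset.cons (a + m + 2) (Finset.Icc (a + 1) (a + m + 1)) (by simp) := by
      ext i
      simp only [Finset.mem_cons, Finset.mem_Icc]
      omega
    rw [h, Finset.cons_val, Multiset.map_cons, comb, leaves, ih, leaves, add_comm,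
      Multiset.singleton_add]

theorem core_injective : Function.Injective TTInput.core := fun _ _ h => TTInput.core.inj h

theorem mem_map_core {s : Finset ℕ} {t : TTInput} :
    t ∈ s.val.map TTInput.core ↔ ∃ i ∈ s, TTInput.core i = t := by
  simp

theorem isPartial_of_leaves_eq {d u v : ℕ} {P : ContractionTree} (hu : 1 ≤ u) (hv : v ≤ 2 * d)
    (h : P.leaves = (Finset.Icc u v).val.map TTInput.core) :
    P.IsPartial d ∧ TTInput.X ∉ P.leaves ∧
      ∀ i, TTInput.core i ∈ P.leaves ↔ u ≤ i ∧ i ≤ v := by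
  have hmem : ∀ i, TTInput.core i ∈ P.leaves ↔ u ≤ i ∧ i ≤ v := fun i => by
    simp [h]
  refine ⟨⟨?_, fun i hi => ?_⟩, by simp [h], hmem⟩
  · rw [h]
    exact (Finset.nodup _).map core_injective
  · have := (hmem i).1 hi
    omega

theorem isPartial_of_leaves_eq_cons {d v : ℕ} {P : ContractionTree} (hv : v ≤ 2 * d)
    (h : P.leaves = TTInput.X ::ₘ (Finset.Icc 1 v).val.map TTInput.core) :
    P.IsPartial d ∧ TTInput.X ∈ P.leaves ∧
      ∀ i, TTInput.core i ∈ P.leaves ↔ 1 ≤ i ∧ i ≤ v := by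
  have hmem : ∀ i, TTInput.core i ∈ P.leaves ↔ 1 ≤ i ∧ i ≤ v := fun i => by
    simp [h]
  refine ⟨⟨?_, fun i hi => ?_⟩, by simp [h], hmem⟩
  · rw [h, Multiset.nodup_cons]
    exact ⟨by simp, (Finset.nodup _).map core_injective⟩
  · have := (hmem i).1 hi
    omega

theorem IsSequential.congr {V V' : ℕ → ContractionTree} {k : ℕ} {P : ContractionTree}
    (hV : ∀ i ∈ Finset.Icc 1 k, V i = V' i) (h : IsSequential V k P) : IsSequential V' k P := by
  induction k generalizing P with
  | zero => exact h
  | succ k ih =>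
    obtain ⟨Q, hQ, hP⟩ := h
    refine ⟨Q, ih (fun i hi => hV i ?_) hQ, ?_⟩
    · rw [Finset.mem_Icc] at hi ⊢
      omega
    · rwa [← hV (k + 1) (by simp)]

/-- `P` contracts `X` with tensors of consecutive cores, in order, up to core `e`. -/
def HasSequentialForm (d : ℕ) (P : ContractionTree) (e : ℕ) : Prop :=
  ∃ (k : ℕ) (j : ℕ → ℕ) (V : ℕ → ContractionTree),
    j 1 = 0 ∧ j (k + 1) = e ∧
    (∀ i ∈ Finset.Icc 1 k,
      j i < j (i + 1) ∧
      (V i).leaves = (Finset.Icc (j i + 1) (j (i + 1))).val.map TTInput.core ∧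
      (V i).indices d =
        {TTIndex.bond (j i), TTIndex.bond (j (i + 1))} ∪
          (Finset.Icc (j i + 1) (j (i + 1))).image TTIndex.mode) ∧
    IsSequential V k P

theorem hasSequentialForm_X (d : ℕ) : HasSequentialForm d (input TTInput.X) 0 :=
  ⟨0, fun _ => 0, fun _ => input TTInput.X, rfl, rfl, by simp, rfl⟩

theorem indices_of_leaves_eq {d u v : ℕ} {P : ContractionTree} (huv : u < v) (hv : v ≤ 2 * d)
    (h : P.leaves = (Finset.Icc (u + 1) v).val.map TTInput.core) :
    P.indices d = {TTIndex.bond u, TTIndex.bond v} ∪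
      (Finset.Icc (u + 1) v).image TTIndex.mode := by
  obtain ⟨hP, hX, hc⟩ := isPartial_of_leaves_eq (Nat.le_add_left 1 u) hv h
  ext a
  cases a with
  | batch => simp [hP.mem_indices.1, hX]
  | mode i => simp [hP.mem_indices.2.1, hX, hc, xor_def]
  | bond i =>
    simp [hP.mem_indices.2.2, hc, xor_def]
    omega

theorem HasSequentialForm.step {d e e' : ℕ} {P Q S : ContractionTree}
    (hQ : HasSequentialForm d Q e) (hlt : e < e') (he' : e' ≤ 2 * d)
    (hS : S.leaves = (Finset.Icc (e + 1) e').val.map TTInput.core)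
    (hP : P = contract Q S ∨ P = contract S Q) : HasSequentialForm d P e' := by
  obtain ⟨k, j, V, h1, hk, hV, hseq⟩ := hQ
  refine ⟨k + 1, Function.update j (k + 2) e', Function.update V (k + 1) S, ?_, ?_, ?_, Q, ?_, ?_⟩
  · rw [Function.update_of_ne (by omega), h1]
  · rw [Function.update_self]
  · intro i hi
    rw [Finset.mem_Icc] at hi
    rw [Function.update_of_ne (show i ≠ k + 2 by omega)]
    rcases Nat.lt_or_ge k i with hik | hik
    · obtain rfl : i = k + 1 := by omega
      rw [Function.update_self, Function.update_self, hk]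
      exact ⟨hlt, hS, indices_of_leaves_eq hlt he' hS⟩
    · rw [Function.update_of_ne (show i + 1 ≠ k + 2 by omega),
        Function.update_of_ne (show i ≠ k + 1 by omega)]
      exact hV i (Finset.mem_Icc.2 ⟨hi.1, hik⟩)
  · refine hseq.congr fun i hi => ?_
    rw [Finset.mem_Icc] at hi
    rw [Function.update_of_ne (by omega)]
  · rwa [Function.update_self]

/-! ### The front of a set of cores -/

/-- `e` is the front of the set `U` of cores: the last core in `U` up to `d` if `d ∉ U`, and the
end of the run of `U` that contains `d` otherwise. -/
structure IsFront (d : ℕ) (U : ℕ → Prop) (e : ℕ) : Prop where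
  le_of_le : ∀ i, U i → i ≤ d → i ≤ e
  mem_of_le : ∀ i, d ≤ i → i ≤ e → U i
  mem : e = 0 ∨ U e
  succ_notMem : ¬ U (e + 1)

/-- Enlarging a set can only lengthen the run through `d`. If the larger set still misses `d`, its
last core up to `d` can only move right. -/
theorem IsFront.mono {d e e' : ℕ} {U U' : ℕ → Prop} (h : IsFront d U e) (h' : IsFront d U' e')
    (hU : ∀ i, U i → U' i) : e ≤ e' := by
  by_contra! hlt
  rcases Nat.lt_or_ge e' d with hd | hd
  · rcases Nat.lt_or_ge d e with he | he
    · have := h'.le_of_le d (hU d (h.mem_of_le d le_rfl he.le)) le_rfl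
      omega
    · have := h'.le_of_le e (hU e (h.mem.resolve_left (by omega))) he
      omega
  · exact h'.succ_notMem (hU _ (h.mem_of_le _ (by omega) hlt))

theorem exists_isFront {d m : ℕ} (hd : 1 ≤ d) {U : ℕ → Prop} (hU : ∀ i, U i → 1 ≤ i ∧ i ≤ m) :
    ∃ e, IsFront d U e := by
  classical
  by_cases hdU : U d
  · have hex : ∃ e, d ≤ e ∧ ¬ U (e + 1) :=
      -- Core `d + m + 1` exceeds the bound `m`, so the run through `d` must end.
      ⟨d + m, by omega, fun h => by have := hU _ h; omega⟩
    have hspec := Nat.find_spec hex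
    have hmem : ∀ i, d ≤ i → i ≤ Nat.find hex → U i := by
      intro i hdi hi
      rcases hdi.eq_or_lt with rfl | hlt
      · exact hdU
      · have := Nat.find_min hex (m := i - 1) (by omega)
        rw [Nat.sub_add_cancel (by omega)] at this
        by_contra hn
        exact this ⟨by omega, hn⟩
    exact ⟨Nat.find hex, fun i _ hi => hi.trans hspec.1, hmem,
      Or.inr (hmem _ hspec.1 le_rfl), hspec.2⟩
  · have hle : Nat.findGreatest U d ≤ d := Nat.findGreatest_le d
    have hmem : Nat.findGreatest U d = 0 ∨ U (Nat.findGreatest U d) := by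
      rcases Nat.eq_zero_or_pos (Nat.findGreatest U d) with h | h
      · exact Or.inl h
      · exact Or.inr (Nat.findGreatest_of_ne_zero rfl h.ne')
    have hne : Nat.findGreatest U d ≠ d := fun h => by
      rw [h] at hmem
      exact hmem.elim (by omega) hdU
    refine ⟨Nat.findGreatest U d, fun i hi hid => Nat.le_findGreatest hid hi, ?_, hmem, ?_⟩
    · intro i h1 h2
      omega
    · intro h
      have := Nat.le_findGreatest (n := d) (by omega) h
      omega

/-! ### Comparing the indices of an old and a new step -/

/-- Contracting `X` with the cores of `U₁` and then with further cores needs all the indices that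
are needed on the initial segments given by the fronts, the boundary bond `0` excepted. -/
theorem indices_front_subset {d e₁ e : ℕ} {P₁ P₂ Q₁ S : ContractionTree}
    (hP : (contract P₁ P₂).IsPartial d) (hX : TTInput.X ∈ P₁.leaves)
    (h₁ : IsFront d (fun i => TTInput.core i ∈ P₁.leaves) e₁)
    (h : IsFront d (fun i => TTInput.core i ∈ (contract P₁ P₂).leaves) e)
    (hlt : e₁ < e) (he : e ≤ 2 * d)
    (hQ : Q₁.leaves = TTInput.X ::ₘ (Finset.Icc 1 e₁).val.map TTInput.core)
    (hS : S.leaves = (Finset.Icc (e₁ + 1) e).val.map TTInput.core) :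
    (Q₁.indices d ∪ S.indices d).erase (TTIndex.bond 0) ⊆ P₁.indices d ∪ P₂.indices d := by
  obtain ⟨hp1, hp2, hdis⟩ := hP.of_contract
  obtain ⟨hQ1, hQX, hQc⟩ := isPartial_of_leaves_eq_cons (by omega : e₁ ≤ 2 * d) hQ
  obtain ⟨hS1, hSX, hSc⟩ := isPartial_of_leaves_eq (Nat.le_add_left 1 e₁) he hS
  have hX2 := hdis _ hX
  have hsymm : P₁.indices d ∪ P₂.indices d ⊇ (contract P₁ P₂).indices d := fun a ha => by
    rw [indices, Finset.mem_symmDiff] at ha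
    rw [Finset.mem_union]
    tauto
  intro a ha
  rw [Finset.mem_erase, Finset.mem_union] at ha
  obtain ⟨ha0, ha⟩ := ha
  cases a with
  | batch => exact Finset.mem_union_left _ (hp1.mem_indices.1.2 hX)
  | mode i =>
    rw [hQ1.mem_indices.2.1, hS1.mem_indices.2.1, hQc, hSc] at ha
    rw [Finset.mem_union, hp1.mem_indices.2.1, hp2.mem_indices.2.1]
    have m1 := h₁.le_of_le i
    have m2 := h₁.mem_of_le i
    have m3 := h.mem_of_le i
    have m4 := hdis (TTInput.core i)
    simp only [mem_leaves_contract] at m3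
    simp only [xor_def, hX, hX2, hQX, hSX, true_and, false_and, not_false_eq_true, and_true,
      false_or] at ha ⊢
    -- A mode beyond `d` belongs to a single core and is never summed; here that core is absorbed,
    -- since `d < i ≤ e`. A mode `i ≤ d` with `e₁ < i` is still open on `X`, because core `i` lies
    -- past the front of `P₁`.
    rcases Nat.lt_or_ge d i with hi | hi
    · have hid : ¬ (1 ≤ i ∧ i ≤ d) := by omega
      have := m3 hi.le (by omega)
      simp only [hid, false_and, false_or, not_false_eq_true, and_true]
      tauto
    · have : e₁ < i := by omega
      have : TTInput.core i ∉ P₁.leaves := fun hc => by have := m1 hc hi; omega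
      exact Or.inl (Or.inl ⟨by omega, this⟩)
  | bond i =>
    rw [hQ1.mem_indices.2.2, hS1.mem_indices.2.2, hQc, hSc, hQc, hSc] at ha
    have hi0 : i ≠ 0 := fun h0 => ha0 (by rw [h0])
    have hi : i = e₁ ∨ i = e := by
      simp only [xor_def] at ha
      omega
    rcases hi with rfl | rfl
    · refine Finset.mem_union_left _ ((hp1.mem_indices.2.2 i).2 (Or.inl ⟨?_, h₁.succ_notMem⟩))
      exact h₁.mem.resolve_left hi0
    · refine hsymm ((hP.mem_indices.2.2 i).2 (Or.inl ⟨?_, h.succ_notMem⟩))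
      exact h.mem.resolve_left hi0

/-- If a set of cores is not an initial segment, then the tensor of `X` and these cores has an
index of dimension at least two that does not occur on the initial segments. -/
theorem exists_extra_index {b d e₁ e : ℕ} {n r : ℕ → ℕ} (hr_zero : r 0 = 1) (hr_one : r 0 < r 1)
    (hr_up : ∀ i, 1 ≤ i → i < d → r i ≤ r (i + 1))
    (hr_down : ∀ i, d ≤ i → i < 2 * d → r (i + 1) ≤ r i)
    (hcore : ∀ i, i < 2 * d → 1 < r i * n (i + 1) * r (i + 1))
    {P Q₁ S : ContractionTree}
    (hP : P.IsPartial d) (h : IsFront d (fun i => TTInput.core i ∈ P.leaves) e)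
    (he₁ : e₁ = 0 ∨ TTInput.core e₁ ∈ P.leaves)
    (hlt : e₁ < e) (he : e ≤ 2 * d)
    (hQ : Q₁.leaves = TTInput.X ::ₘ (Finset.Icc 1 e₁).val.map TTInput.core)
    (hS : S.leaves = (Finset.Icc (e₁ + 1) e).val.map TTInput.core)
    (hne : ¬ ∀ i, TTInput.core i ∈ P.leaves ↔ 1 ≤ i ∧ i ≤ e) :
    ∃ a ∈ P.indices d, a ∉ Q₁.indices d ∪ S.indices d ∧ 2 ≤ a.dim b n r := by
  obtain ⟨hQ1, hQX, hQc⟩ := isPartial_of_leaves_eq_cons (by omega : e₁ ≤ 2 * d) hQ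
  obtain ⟨hS1, hSX, hSc⟩ := isPartial_of_leaves_eq (Nat.le_add_left 1 e₁) he hS
  have hbond : ∀ i, i ≠ 0 → i ≠ e₁ → i ≠ e →
      TTIndex.bond i ∉ Q₁.indices d ∪ S.indices d := by
    intro i h0 h1 h2
    rw [Finset.mem_union, hQ1.mem_indices.2.2, hS1.mem_indices.2.2, hQc, hSc, hQc, hSc]
    simp only [xor_def]
    omega
  have hne' : (∃ i, TTInput.core i ∉ P.leaves ∧ 1 ≤ i ∧ i ≤ e) ∨
      ∃ i, TTInput.core i ∈ P.leaves ∧ e < i := by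
    by_contra! hc
    refine hne fun i => ⟨fun hi => ⟨(hP.range i hi).1, hc.2 i hi⟩, fun hi => ?_⟩
    by_contra hi'
    have := hc.1 i hi' hi.1
    omega
  rcases hne' with ⟨i, hi, hi1, hie⟩ | hex
  · have hid : i < d := by
      by_contra! hdi
      exact hi (h.mem_of_le i hdi hie)
    have hm : TTInput.core (min d e) ∈ P.leaves := by
      rcases le_total d e with hde | hde
      · rw [min_eq_left hde]
        exact h.mem_of_le d le_rfl hde
      · rw [min_eq_right hde]
        exact h.mem.resolve_left (by omega)
    -- Between the gap `i` and the absorbed core `min d e`, some missing core precedes an absorbed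
    -- one. The bond joining them is open, and its rank is at least `r 1 ≥ 2` since ranks do not
    -- decrease up to `d`.
    have hstep : ∃ c, i ≤ c ∧ c < min d e ∧ TTInput.core c ∉ P.leaves ∧
        TTInput.core (c + 1) ∈ P.leaves := by
      by_contra! hc
      have hall : ∀ c, i ≤ c → c ≤ min d e → TTInput.core c ∉ P.leaves := by
        intro c hic
        induction c, hic using Nat.le_induction with
        | base => exact fun _ => hi
        | succ c hic ih => exact fun hcm => hc c hic (by omega) (ih (by omega))
      exact hall _ (by omega) le_rfl hm
    obtain ⟨c, hic, hcm, hc, hc'⟩ := hstep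
    have hmono : ∀ c, 1 ≤ c → c ≤ d → r 1 ≤ r c := by
      intro c h1
      induction c, h1 using Nat.le_induction with
      | base => exact fun _ => le_rfl
      | succ c h1 ih => exact fun hcd => (ih (by omega)).trans (hr_up c h1 (by omega))
    refine ⟨TTIndex.bond c, (hP.mem_indices.2.2 c).2 (Or.inr ⟨hc', hc⟩),
      hbond c (by omega) ?_ (by omega), ?_⟩
    · rintro rfl
      exact hc (he₁.resolve_left (by omega))
    · have := hmono c (by omega) (by omega)
      change 2 ≤ r c
      omega
  · classical
    -- The first absorbed core beyond the front has a missing left neighbour, so its left bond is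
    -- open.
    obtain ⟨ha, hae⟩ := Nat.find_spec hex
    have hmin := fun m => Nat.find_min hex (m := m)
    generalize Nat.find hex = a at ha hae hmin
    have had : d < a := by
      by_contra! hc
      have := h.le_of_le a ha hc
      omega
    have hpred : TTInput.core (a - 1) ∉ P.leaves := by
      intro hc
      rcases Nat.lt_or_ge e (a - 1) with hlt' | hge
      · exact hmin (a - 1) (by omega) ⟨hc, hlt'⟩
      · obtain rfl : a = e + 1 := by omega
        exact h.succ_notMem ha
    have hne_e : a - 1 ≠ e := fun h' => by
      obtain rfl : a = e + 1 := by omega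
      exact h.succ_notMem ha
    obtain ⟨a, rfl⟩ : ∃ c, a = c + 1 := ⟨a - 1, by omega⟩
    rw [Nat.add_sub_cancel] at hpred hne_e
    have ha2 := (hP.range _ ha).2
    have hdown := hr_down a (by omega) (by omega)
    have hc := hcore a (by omega)
    -- If the left bond has dimension one, so has the right one, as ranks do not increase from `d`
    -- on. The core has more than one entry, so its mode is the index sought.
    rcases Nat.lt_or_ge (r a) 2 with hra | hra
    · refine ⟨TTIndex.mode (a + 1), (hP.mem_indices.2.1 _).2 (Or.inr ⟨ha, by omega⟩), ?_, ?_⟩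
      · rw [Finset.mem_union, hQ1.mem_indices.2.1, hS1.mem_indices.2.1, hQc, hSc]
        simp only [xor_def, hSX]
        omega
      · change 2 ≤ n (a + 1)
        have h1 : r a * n (a + 1) * r (a + 1) ≤ 1 * n (a + 1) * 1 := by
          gcongr <;> omega
        omega
    · exact ⟨TTIndex.bond a, (hP.mem_indices.2.2 a).2 (Or.inr ⟨ha, hpred⟩),
        hbond a (by omega) (by omega) hne_e, hra⟩

theorem le_prod_of_mem {s : Finset TTIndex} {f : TTIndex → ℕ} (hf : ∀ a ∈ s, 1 ≤ f a)
    {a : TTIndex} (ha : a ∈ s) : f a ≤ ∏ x ∈ s, f x :=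
  Nat.le_of_dvd (Finset.prod_pos hf) (Finset.dvd_prod_of_mem f ha)

/-- The extra index at least doubles the product, and the product over `s` is at least `f c`. With
`c` the batch index, the gain is at least `b`. -/
theorem prod_add_le_prod {s t : Finset TTIndex} {f : TTIndex → ℕ} (hst : s ⊆ t)
    (hf : ∀ a ∈ t, 1 ≤ f a) {a c : TTIndex} (ha : a ∈ t) (has : a ∉ s) (h2 : 2 ≤ f a)
    (hc : c ∈ s) : ∏ x ∈ s, f x + f c ≤ ∏ x ∈ t, f x := by
  have h1 : f a ≤ ∏ x ∈ t \ s, f x :=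
    le_prod_of_mem (fun x hx => hf x (Finset.mem_sdiff.1 hx).1) (Finset.mem_sdiff.2 ⟨ha, has⟩)
  have h3 : f c ≤ ∏ x ∈ s, f x := le_prod_of_mem (fun x hx => hf x (hst hx)) hc
  calc ∏ x ∈ s, f x + f c ≤ 2 * ∏ x ∈ s, f x := by omega
    _ ≤ (∏ x ∈ t \ s, f x) * ∏ x ∈ s, f x := Nat.mul_le_mul_right _ (h2.trans h1)
    _ = ∏ x ∈ t, f x := Finset.prod_sdiff hst

/-! ### The exchange argument along the branch of `X` -/

/-- Replacing a tree by a sequential one on the initial segment given by its front costs at most a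
constant, and saves a multiple of the batch size if the tree is not itself of this form. -/
theorem exists_sequential_flops_le {b d F : ℕ} {n r : ℕ → ℕ} (hd : 1 ≤ d)
    (hr_zero : r 0 = 1) (hr_one : r 0 < r 1)
    (hr_up : ∀ i, 1 ≤ i → i < d → r i ≤ r (i + 1))
    (hr_down : ∀ i, d ≤ i → i < 2 * d → r (i + 1) ≤ r i)
    (hcore : ∀ i, i < 2 * d → 1 < r i * n (i + 1) * r (i + 1)) (hb : 1 ≤ b)
    (hF : ∀ a m, a + m + 1 ≤ 2 * d → (comb a m).flops b d n r ≤ F)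
    {P : ContractionTree} (hP : P.IsPartial d) (hX : TTInput.X ∈ P.leaves) :
    ∃ (e : ℕ) (Q : ContractionTree),
      IsFront d (fun i => TTInput.core i ∈ P.leaves) e ∧
      Q.leaves = TTInput.X ::ₘ (Finset.Icc 1 e).val.map TTInput.core ∧
      Q.flops b d n r ≤ P.flops b d n r + e * F ∧
      (Q.flops b d n r + b ≤ P.flops b d n r + e * F ∨
        (∀ i, TTInput.core i ∈ P.leaves ↔ 1 ≤ i ∧ i ≤ e) ∧ HasSequentialForm d P e) := by
  induction P with
  | input t =>
    obtain rfl : t = TTInput.X := (Multiset.mem_singleton.1 hX).symm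
    refine ⟨0, input TTInput.X, ⟨?_, ?_, Or.inl rfl, ?_⟩, ?_, ?_, Or.inr ⟨?_, ?_⟩⟩
    · simp [leaves]
    · intro i h1 h2
      omega
    · simp [leaves]
    · simp [leaves]
    · simp
    · intro i
      simp [leaves]
      omega
    · exact hasSequentialForm_X d
  | contract A B hA hB =>
    -- Here `P₁` is the operand containing `X`, whichever side it stands on.
    have key : ∀ P P₁ P₂ : ContractionTree, P.IsPartial d → TTInput.X ∈ P₁.leaves →
        (P = contract P₁ P₂ ∨ P = contract P₂ P₁) →
        (∃ (e : ℕ) (Q : ContractionTree),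
          IsFront d (fun i => TTInput.core i ∈ P₁.leaves) e ∧
          Q.leaves = TTInput.X ::ₘ (Finset.Icc 1 e).val.map TTInput.core ∧
          Q.flops b d n r ≤ P₁.flops b d n r + e * F ∧
          (Q.flops b d n r + b ≤ P₁.flops b d n r + e * F ∨
            (∀ i, TTInput.core i ∈ P₁.leaves ↔ 1 ≤ i ∧ i ≤ e) ∧ HasSequentialForm d P₁ e)) →
        ∃ (e : ℕ) (Q : ContractionTree),
          IsFront d (fun i => TTInput.core i ∈ P.leaves) e ∧
          Q.leaves = TTInput.X ::ₘ (Finset.Icc 1 e).val.map TTInput.core ∧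
          Q.flops b d n r ≤ P.flops b d n r + e * F ∧
          (Q.flops b d n r + b ≤ P.flops b d n r + e * F ∨
            (∀ i, TTInput.core i ∈ P.leaves ↔ 1 ≤ i ∧ i ≤ e) ∧ HasSequentialForm d P e) := by
      clear hA hB hP hX A B
      intro P P₁ P₂ hP hX hform ⟨e₁, Q₁, hfr, hQl, hQf, hQs⟩
      have hl : P.leaves = (contract P₁ P₂).leaves := by
        rcases hform with rfl | rfl
        · rfl
        · exact leaves_contract_comm _ _
      have hfl : P.flops b d n r = P₁.flops b d n r + P₂.flops b d n r +
          ∏ a ∈ P₁.indices d ∪ P₂.indices d, a.dim b n r := by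
        rcases hform with rfl | rfl
        · rfl
        · exact flops_contract_comm _ _ _ _ _ _
      have hPc : (contract P₁ P₂).IsPartial d := ⟨hl ▸ hP.nodup, hl ▸ hP.range⟩
      rw [hl]
      obtain ⟨e, hef⟩ := exists_isFront hd (U := fun i => TTInput.core i ∈ (contract P₁ P₂).leaves)
        hPc.range
      obtain ⟨hp1, hp2, hdis⟩ := hPc.of_contract
      have hle : e₁ ≤ e := hfr.mono hef fun i hi => mem_leaves_contract.2 (Or.inl hi)
      have he2 : e ≤ 2 * d := by
        rcases hef.mem with h0 | h0
        · omega
        · exact (hPc.range e h0).2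
      have hpos : ∀ a ∈ P₁.indices d ∪ P₂.indices d, 1 ≤ a.dim b n r := fun a ha => by
        rcases Finset.mem_union.1 ha with ha | ha
        · exact hp1.dim_pos hcore hb ha
        · exact hp2.dim_pos hcore hb ha
      have hbatch : TTIndex.batch ∈ P₁.indices d ∪ P₂.indices d :=
        Finset.mem_union_left _ (hp1.mem_indices.1.2 hX)
      have hstep : b ≤ ∏ a ∈ P₁.indices d ∪ P₂.indices d, a.dim b n r :=
        le_prod_of_mem hpos hbatch
      rcases hle.eq_or_lt with rfl | hlt
      -- The front stays put: `Q₁` is kept and the whole contraction, worth at least `b`, is saved.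
      · exact ⟨e₁, Q₁, hef, hQl, by omega, Or.inl (by omega)⟩
      obtain ⟨m, rfl⟩ : ∃ m, e = e₁ + m + 1 := ⟨e - e₁ - 1, by omega⟩
      have hSl := leaves_comb e₁ m
      have hSF := hF e₁ m he2
      generalize comb e₁ m = S at hSl hSF
      have hsub := indices_front_subset hPc hX hfr hef hlt he2 hQl hSl
      have hprod : ∏ a ∈ (Q₁.indices d ∪ S.indices d).erase (TTIndex.bond 0), a.dim b n r =
          ∏ a ∈ Q₁.indices d ∪ S.indices d, a.dim b n r :=
        Finset.prod_erase _ hr_zero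
      have hcost : ∏ a ∈ Q₁.indices d ∪ S.indices d, a.dim b n r ≤
          ∏ a ∈ P₁.indices d ∪ P₂.indices d, a.dim b n r := by
        rw [← hprod]
        exact Finset.prod_le_prod_of_subset_of_one_le' hsub fun a ha _ => hpos a ha
      have hQ' : (contract Q₁ S).flops b d n r = Q₁.flops b d n r + S.flops b d n r +
        ∏ a ∈ Q₁.indices d ∪ S.indices d, a.dim b n r := rfl
      -- The front advances by at least one core, which pays for the one new chain.
      have hFe : e₁ * F + F ≤ (e₁ + m + 1) * F := by
        nlinarith [Nat.zero_le (m * F)]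
      refine ⟨e₁ + m + 1, contract Q₁ S, hef, ?_, by omega, ?_⟩
      · rw [leaves, hQl, hSl, Multiset.cons_add, ← Multiset.map_add]
        congr 2
        refine (Multiset.Nodup.ext ?_ (Finset.nodup _)).2 fun i => ?_
        · refine Multiset.nodup_add.2 ⟨Finset.nodup _, Finset.nodup _, ?_⟩
          rw [Multiset.disjoint_left]
          intro i h1 h2
          simp only [Finset.mem_val, Finset.mem_Icc] at h1 h2
          omega
        · simp only [Multiset.mem_add, Finset.mem_val, Finset.mem_Icc]
          omega
      rcases hQs with hQs | ⟨hmem, hseq⟩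
      · exact Or.inl (by omega)
      by_cases hall : ∀ i, TTInput.core i ∈ (contract P₁ P₂).leaves ↔ 1 ≤ i ∧ i ≤ e₁ + m + 1
      -- Both absorbed sets are initial segments, so `P₂` consists exactly of the cores between the
      -- fronts.
      · refine Or.inr ⟨hall, hseq.step hlt he2 ?_ hform⟩
        refine (Multiset.Nodup.ext hp2.nodup ((Finset.nodup _).map core_injective)).2 fun t => ?_
        cases t with
        | X => simp [hdis _ hX]
        | core i =>
          have h1 := hall i
          have h2 := hmem i
          have h3 := hdis (TTInput.core i)
          rw [mem_leaves_contract] at h1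
          simp only [mem_map_core, Finset.mem_Icc, TTInput.core.injEq, exists_eq_right]
          constructor
          · intro hi
            have := h1.1 (Or.inr hi)
            have : ¬ (1 ≤ i ∧ i ≤ e₁) := fun hc => h3 (h2.2 hc) hi
            omega
          · intro hi
            refine (h1.2 (by omega)).resolve_left fun hc => ?_
            have := h2.1 hc
            omega
      · left
        have he₁ : e₁ = 0 ∨ TTInput.core e₁ ∈ (contract P₁ P₂).leaves :=
          hfr.mem.imp_right fun hc => mem_leaves_contract.2 (Or.inl hc)
        obtain ⟨a, haP, haQ, ha2⟩ := exists_extra_index (b := b) hr_zero hr_one hr_up hr_down hcore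
          hPc hef he₁ hlt he2 hQl hSl hall
        have haP' : a ∈ P₁.indices d ∪ P₂.indices d := by
          rw [indices, Finset.mem_symmDiff] at haP
          rw [Finset.mem_union]
          tauto
        have hQp := isPartial_of_leaves_eq_cons (by omega : e₁ ≤ 2 * d) hQl
        have hcQ : TTIndex.batch ∈ (Q₁.indices d ∪ S.indices d).erase (TTIndex.bond 0) :=
          Finset.mem_erase.2 ⟨by simp, Finset.mem_union_left _ (hQp.1.mem_indices.1.2 hQp.2.1)⟩
        have hsave : _ + b ≤ _ := prod_add_le_prod hsub hpos haP'
          (fun hc => haQ (Finset.mem_of_mem_erase hc)) ha2 hcQ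
        rw [hprod] at hsave
        omega
    obtain ⟨h1, h2, -⟩ := hP.of_contract
    rcases mem_leaves_contract.1 hX with hXA | hXB
    · exact key _ A B hP hXA (Or.inl rfl) (hA h1 hXA)
    · exact key _ B A hP hXB (Or.inr rfl) (hB h2 hXB)

/-! ### Existence of an optimum and the threshold batch size -/

theorem exists_isFlopOptimal {b d : ℕ} (hd : 1 ≤ d) (n r : ℕ → ℕ) :
    ∃ P : ContractionTree, P.IsFlopOptimal b d n r := by
  classical
  have hex : ∃ c, ∃ P : ContractionTree, P.IsForwardPath d ∧ P.flops b d n r = c := by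
    refine ⟨_, contract (input TTInput.X) (comb 0 (2 * d - 1)), ?_, rfl⟩
    rw [IsForwardPath, leaves, leaves_comb, leaves, Multiset.singleton_add, zero_add, zero_add,
      Nat.sub_add_cancel (by omega)]
  obtain ⟨P, hP, hc⟩ := Nat.find_spec hex
  exact ⟨P, hP, fun Q hQ => hc.trans_le (Nat.find_min' hex ⟨Q, hQ, rfl⟩)⟩

end ContractionTree

theorem proposition2 (d : ℕ) (hd : 1 ≤ d) (n r : ℕ → ℕ)
    (hr_zero : r 0 = 1) (hr_one : r 0 < r 1)
    (hr_up : ∀ i, 1 ≤ i → i < d → r i ≤ r (i + 1))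
    (hr_down : ∀ i, d ≤ i → i < 2 * d → r (i + 1) ≤ r i)
    (hr_last : r (2 * d) = 1)
    (hcore : ∀ i, i < 2 * d → 1 < r i * n (i + 1) * r (i + 1)) :
    ∃ b₀ : ℕ, ∀ b : ℕ, b₀ ≤ b →
      (∃ P : ContractionTree, P.IsFlopOptimal b d n r) ∧
      ∀ P : ContractionTree, P.IsFlopOptimal b d n r →
        ∃ (k : ℕ) (j : ℕ → ℕ) (V : ℕ → ContractionTree),
          1 ≤ k ∧ j 1 = 0 ∧ j (k + 1) = 2 * d ∧
          (∀ i ∈ Finset.Icc 1 k,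
            j i < j (i + 1) ∧
            (V i).leaves = (Finset.Icc (j i + 1) (j (i + 1))).val.map TTInput.core ∧
            (V i).indices d =
              {TTIndex.bond (j i), TTIndex.bond (j (i + 1))} ∪
                (Finset.Icc (j i + 1) (j (i + 1))).image TTIndex.mode) ∧
          ContractionTree.IsSequential V k P := by

  let F := ∑ a ∈ Finset.range (2 * d), ∑ m ∈ Finset.range (2 * d),
    (ContractionTree.comb a m).flops 1 d n r
  refine ⟨2 * d * F + 1, fun b hb =>
    ⟨ContractionTree.exists_isFlopOptimal hd n r, fun P ⟨hP, hopt⟩ => ?_⟩⟩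
  have hF : ∀ a m, a + m + 1 ≤ 2 * d → (ContractionTree.comb a m).flops b d n r ≤ F := by
    intro a m ham
    obtain ⟨hp, hX, -⟩ := ContractionTree.isPartial_of_leaves_eq (Nat.le_add_left 1 a) ham
      (ContractionTree.leaves_comb a m)
    rw [hp.flops_eq hX n r b 1]
    refine le_trans ?_ (Finset.single_le_sum (fun _ _ => Nat.zero_le _)
      (Finset.mem_range.2 (by omega : a < 2 * d)))
    exact Finset.single_le_sum (f := fun m => (ContractionTree.comb a m).flops 1 d n r)
      (fun _ _ => Nat.zero_le _) (Finset.mem_range.2 (by omega : m < 2 * d))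
  obtain ⟨hpart, hX, hmem⟩ := ContractionTree.isPartial_of_leaves_eq_cons le_rfl hP
  obtain ⟨e, Q, hfr, hQl, -, hQ⟩ := ContractionTree.exists_sequential_flops_le hd hr_zero hr_one
    hr_up hr_down hcore (by omega : 1 ≤ b) hF hpart hX
  have hde : d ≤ e := hfr.le_of_le d ((hmem d).2 ⟨hd, by omega⟩) le_rfl
  have hle : e ≤ 2 * d := ((hmem e).1 (hfr.mem.resolve_left (by omega))).2
  obtain rfl : e = 2 * d := by
    by_contra hne
    exact hfr.succ_notMem ((hmem _).2 ⟨by omega, by omega⟩)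
  rcases hQ with hQ | ⟨-, k, j, V, h1, hk, hV, hseq⟩
  -- A saving of `b > 2 * d * F` would make `Q` strictly cheaper than the optimal `P`.
  · have := hopt Q hQl
    omega
  · refine ⟨k, j, V, ?_, h1, hk, hV, hseq⟩
    by_contra hk0
    obtain rfl : k = 0 := by omega
    rw [zero_add, h1] at hk
    omega
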